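/- Let $f\in\mathbb{C}[x_0,x_1,x_2]$ be a homogeneous polynomial of degree $2$ defining a non-singular conic $C=\{f=0\}$ in the complex projective plane $\mathbf{P}^2$ that is tangent to each of the three coordinate lines $L_i=\{x_i=0\}$, $i=0,1,2$ (for example $f=x_0^2+x_1^2+x_2^2+2(x_0x_2-x_0x_1+x_1x_2)$). For an integer $n\ge 2$, let $$\tilde{C}_n=\{[x_0:x_1:x_2]\in\mathbf{P}^2 \mid f(x_0^n,x_1^n,x_2^n)=0\}$$ be the pull-back of $C$ under the map $[x_0:x_1:x_2]\mapsto[x_0^n:x_1^n:x_2^n]$. Then $\tilde{C}_n$ is a curve of degree $2n$, that is, $f(x_0^n,x_1^n,x_2^n)$ is a squarefree homogeneous polynomial of degree $2n$. Moreover, $\tilde{C}_n$ has exactly $3n$ singular points, and each of them is of local analytic type $A_{n-1}$: in suitable local holomorphic coordinates $(x,y)$ of $\mathbf{P}^2$ centred at the point, the curve has the equation $y^2=x^n$, i.e. its local equation equals $y^2-x^n$ up to a non-vanishing holomorphic factor. -/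

import Mathlib

/-- The complex projective plane. -/
abbrev ProjPlane : Type := Projectivization ℂ (Fin 3 → ℂ)

/-- The set of zeros in the projective plane of a homogeneous polynomial in `x₀, x₁, x₂`.
Homogeneity makes the condition independent of the vector representing the point;
the same applies to the definitions below. -/
def projZeros (F : MvPolynomial (Fin 3) ℂ) : Set ProjPlane :=
  {p | MvPolynomial.eval p.rep F = 0}

/-- The singular points of the plane curve with homogeneous equation `F = 0`. -/
def singularPoints (F : MvPolynomial (Fin 3) ℂ) : Set ProjPlane :=
  {p | p ∈ projZeros F ∧ ∀ i, MvPolynomial.eval p.rep (MvPolynomial.pderiv i F) = 0}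

/-- `f = 0` is a nonsingular conic in the projective plane. -/
def IsNonsingularConic (f : MvPolynomial (Fin 3) ℂ) : Prop :=
  f.IsHomogeneous 2 ∧ singularPoints f = ∅

/-- The coordinate line `L_i = {x_i = 0}`. -/
def coordLine (i : Fin 3) : Set ProjPlane :=
  projZeros (MvPolynomial.X i)

/-- The projective tangent line at `p` of the curve `F = 0`, for a nonsingular point `p`
(for a singular point this is the whole plane). -/
def tangentLine (F : MvPolynomial (Fin 3) ℂ) (p : ProjPlane) : Set ProjPlane :=
  {q | ∑ j, MvPolynomial.eval p.rep (MvPolynomial.pderiv j F) * q.rep j = 0}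

/-- The curve `F = 0` is tangent to the line `L`: `L` is its tangent line at one of its points. -/
def IsTangentTo (F : MvPolynomial (Fin 3) ℂ) (L : Set ProjPlane) : Prop :=
  ∃ p ∈ projZeros F, tangentLine F p = L

/-- The equation `f(x₀ⁿ, x₁ⁿ, x₂ⁿ)` of the pull-back of the curve `f = 0` under the map
`[x₀ : x₁ : x₂] ↦ [x₀ⁿ : x₁ⁿ : x₂ⁿ]`. -/
noncomputable def pullbackEquation (n : ℕ) (f : MvPolynomial (Fin 3) ℂ) :
    MvPolynomial (Fin 3) ℂ :=
  MvPolynomial.aeval (fun i => MvPolynomial.X i ^ n) f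

/-- The plane curve with equation `F = 0` has degree `d`: `F` is a reduced (squarefree, in
particular nonzero) homogeneous equation, of degree `d`. -/
def IsReducedCurveOfDegree (F : MvPolynomial (Fin 3) ℂ) (d : ℕ) : Prop :=
  F.IsHomogeneous d ∧ F.totalDegree = d ∧ Squarefree F

/-- The germ at `a` of the plane curve `g = 0` in `ℂ²` is analytically of type `A_k`:
there are local holomorphic coordinates `(x, y) = (φ · 0, φ · 1)` centred at `a`, in which `g` is
`y² - x^(k+1)` up to a nowhere vanishing holomorphic factor. -/
def IsTypeAAt (k : ℕ) (g : (Fin 2 → ℂ) → ℂ) (a : Fin 2 → ℂ) : Prop :=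
  ∃ (φ : OpenPartialHomeomorph (Fin 2 → ℂ) (Fin 2 → ℂ)) (u : (Fin 2 → ℂ) → ℂ),
    a ∈ φ.source ∧ φ a = 0 ∧
    AnalyticOnNhd ℂ φ φ.source ∧ AnalyticOnNhd ℂ φ.symm φ.target ∧
    AnalyticOnNhd ℂ u φ.source ∧
    ∀ w ∈ φ.source, u w ≠ 0 ∧ g w = u w * ((φ w 1) ^ 2 - (φ w 0) ^ (k + 1))

/-- The curve `F = 0` in the projective plane has local analytic type `A_k` at `p`, expressed in an
affine chart `x_i = 1` around `p`. (The choice of the chart is immaterial: changes of charts are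
biholomorphic and multiply the dehomogenised equation by a nowhere vanishing function.) -/
def HasLocalTypeA (k : ℕ) (F : MvPolynomial (Fin 3) ℂ) (p : ProjPlane) : Prop :=
  ∃ i : Fin 3, p.rep i ≠ 0 ∧
    IsTypeAAt k (fun w => MvPolynomial.eval (i.insertNth (α := fun _ => ℂ) 1 w) F)
      (fun j => p.rep (i.succAbove j) / p.rep i)

section

open MvPolynomial

/-! Tangency to the three coordinate lines determines the conic up to scaling the coordinates: `f =
tritangentConic l` with all `l i ≠ 0` (`IsNonsingularConic.eq_tritangentConic`). With `yᵢ = lᵢ xᵢⁿ`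
and any labelling `i, j, k`, the pull-back is `(yᵢ + yⱼ - yₖ)² - 4 yᵢ yⱼ`. Its partials are `2n lᵢ
xᵢⁿ⁻¹ (2yᵢ - ∑ y)`, so a singular point has some `xᵢ = 0`; there the equation is `(yⱼ - yₖ)²`, which
leaves `n` points on each line, none on two lines. Near such a point, in the chart `xₖ = 1`, the
functions `yᵢ + yⱼ - yₖ` and `b xᵢ xⱼ` with `bⁿ = 4 lᵢ lⱼ` are coordinates giving `A_{n-1}`. A
multiple component would consist of singular points, hence be a coordinate line, but none lies in
the curve. -/

/-- The conic `∑ yᵢ² - 2 ∑_{i<j} yᵢ yⱼ = 0`, where `yᵢ = lᵢ xᵢ`. -/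
noncomputable def tritangentConic (l : Fin 3 → ℂ) : MvPolynomial (Fin 3) ℂ :=
  2 * ∑ i, (C (l i) * X i) ^ 2 - (∑ i, C (l i) * X i) ^ 2

/-! ### Normal form of a conic tangent to the coordinate lines -/

/-- Euler's identity applied twice; the second partials are constants. -/
theorem exists_symmetric_matrix_of_isHomogeneous_two {f : MvPolynomial (Fin 3) ℂ}
    (hf : f.IsHomogeneous 2) :
    ∃ M : Fin 3 → Fin 3 → ℂ, (∀ i j, M i j = M j i) ∧ f = ∑ i, ∑ j, C (M i j) * X i * X j := by
  have h2 (i j : Fin 3) : pderiv i (pderiv j f) = C (coeff 0 (pderiv i (pderiv j f))) := by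
    have h : (pderiv i (pderiv j f)).IsHomogeneous 0 := hf.pderiv.pderiv
    rwa [← totalDegree_zero_iff_isHomogeneous, totalDegree_eq_zero_iff_eq_C] at h
  have h1 (j : Fin 3) : ∑ i, X i * pderiv i (pderiv j f) = pderiv j f := by
    simpa using (hf.pderiv (i := j)).sum_X_mul_pderiv
  refine ⟨fun i j => coeff 0 (pderiv j (pderiv i f)) / 2, fun i j => ?_, ?_⟩
  · have : pderiv i (pderiv j f) = pderiv j (pderiv i f) := by
      have h : ⁅pderiv (R := ℂ) i, pderiv j⁆ = (0 : Derivation ℂ (MvPolynomial (Fin 3) ℂ) (MvPolynomial (Fin 3) ℂ)) := by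
        ext k
        simp [Derivation.commutator_apply, pderiv_X, Pi.single_apply, apply_ite]
      have := congr($h f)
      rwa [Derivation.commutator_apply, Derivation.zero_apply, sub_eq_zero] at this
    simp only [this]
  · have h0 := hf.sum_X_mul_pderiv
    have hC : (2 : MvPolynomial (Fin 3) ℂ) = C 2 := (map_ofNat C 2).symm
    have : (2 : MvPolynomial (Fin 3) ℂ) ≠ 0 := by simp
    apply mul_left_cancel₀ this
    rw [nsmul_eq_mul, Nat.cast_ofNat] at h0
    rw [← h0, Finset.mul_sum]
    refine Finset.sum_congr rfl fun i _ => ?_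
    rw [← h1 i, Finset.mul_sum, Finset.mul_sum]
    refine Finset.sum_congr rfl fun j _ => ?_
    rw [h2 j i, hC]
    have : C (coeff 0 (pderiv j (pderiv i f))) =
      (C 2 * C (coeff 0 (pderiv j (pderiv i f)) / 2) : MvPolynomial (Fin 3) ℂ) := by
      rw [← C_mul]; congr 1; ring
    rw [this]; ring

/-- Testing the tangent line on the basis vectors it contains kills the other partials. Euler's
identity then reads `pᵢ ∂ᵢf(p) = 0`, and nonsingularity forces `pᵢ = 0`. -/
theorem IsTangentTo.exists_gradient {f : MvPolynomial (Fin 3) ℂ} (hf : IsNonsingularConic f)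
    {i : Fin 3} (h : IsTangentTo f (coordLine i)) :
    ∃ p : Fin 3 → ℂ, p ≠ 0 ∧ p i = 0 ∧ ∀ j, j ≠ i → eval p (pderiv j f) = 0 := by
  obtain ⟨p, hp, hL⟩ := h
  have hgrad (j : Fin 3) (hj : j ≠ i) : eval p.rep (pderiv j f) = 0 := by
    have hne : (Pi.single j 1 : Fin 3 → ℂ) ≠ 0 := by simp
    obtain ⟨a, ha⟩ := Projectivization.exists_smul_eq_mk_rep ℂ _ hne
    have hq : Projectivization.mk ℂ _ hne ∈ coordLine i := by
      simp [coordLine, projZeros, ← ha, hj.symm]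
    rw [← hL] at hq
    simpa [tangentLine, ← ha, Units.smul_def, Pi.single_apply] using hq
  refine ⟨p.rep, p.rep_nonzero, ?_, hgrad⟩
  have he := congr(eval p.rep $(hf.1.sum_X_mul_pderiv))
  have hp' : eval p.rep f = 0 := hp
  simp only [map_sum, map_mul, eval_X, nsmul_eq_mul, hp', mul_zero] at he
  rw [Finset.sum_eq_single i (fun j _ hj => by rw [hgrad j hj, mul_zero]) (by simp)] at he
  refine (mul_eq_zero.mp he).resolve_right fun h0 => ?_
  have : p ∈ singularPoints f := ⟨hp, fun j => by
    by_cases hj : j = i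
    · rw [hj, h0]
    · exact hgrad j hj⟩
  simp [hf.2] at this

theorem IsNonsingularConic.eq_zero_of_gradient {f : MvPolynomial (Fin 3) ℂ}
    (hf : IsNonsingularConic f) {M : Fin 3 → Fin 3 → ℂ}
    (hg : ∀ x i, eval x (pderiv i f) = 2 * ∑ j, M i j * x j)
    (x : Fin 3 → ℂ) (hx : ∀ i, ∑ j, M i j * x j = 0) : x = 0 := by
  by_contra hne
  obtain ⟨a, ha⟩ := Projectivization.exists_smul_eq_mk_rep ℂ _ hne
  have hd (i) : eval (Projectivization.mk ℂ x hne).rep (pderiv i f) = 0 := by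
    have : ∑ j, M i j * (a * x j) = a * ∑ j, M i j * x j := by
      rw [Finset.mul_sum]; exact Finset.sum_congr rfl fun j _ => by ring
    simp [← ha, hg, Units.smul_def, this, hx]
  have : Projectivization.mk ℂ x hne ∈ singularPoints f := by
    refine ⟨?_, hd⟩
    have he := congr(eval (Projectivization.mk ℂ x hne).rep $(hf.1.sum_X_mul_pderiv))
    simpa [hd, projZeros] using he.symm
  simp [hf.2] at this

theorem mul_eq_sq_of_mul_add_eq_zero {a b c u v : ℂ} (h : u ≠ 0 ∨ v ≠ 0)
    (h1 : a * u + b * v = 0) (h2 : b * u + c * v = 0) : a * c = b ^ 2 := by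
  rcases h with h | h <;> apply mul_right_cancel₀ h
  · linear_combination c * h1 - b * h2
  · linear_combination a * h2 - b * h1

/-- Tangency makes the principal 2×2 minors of `M` vanish, so `m₀₁m₀₂m₁₂ = ± m₀₀m₁₁m₂₂`. The plus
sign would give `det M = 0`; the minus sign allows square roots `lᵢ` of `mᵢᵢ` with `lᵢlⱼ = -mᵢⱼ`. -/
theorem IsNonsingularConic.eq_tritangentConic {f : MvPolynomial (Fin 3) ℂ}
    (hf : IsNonsingularConic f) (htan : ∀ i : Fin 3, IsTangentTo f (coordLine i)) :
    ∃ l : Fin 3 → ℂ, (∀ i, l i ≠ 0) ∧ f = tritangentConic l := by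
  obtain ⟨M, hM, hfM⟩ := exists_symmetric_matrix_of_isHomogeneous_two hf.1
  have hg (x i) : eval x (pderiv i f) = 2 * ∑ j, M i j * x j := by
    rw [hfM]
    fin_cases i <;> simp [Fin.sum_univ_three, pderiv_X, hM 1 0, hM 2 0, hM 2 1] <;>
      ring
  have hker := hf.eq_zero_of_gradient hg
  have tan (i) := (htan i).exists_gradient hf
  simp only [hg, mul_eq_zero, OfNat.ofNat_ne_zero, false_or, Fin.sum_univ_three] at tan hker
  have h12 : M 1 1 * M 2 2 = M 1 2 ^ 2 := by
    obtain ⟨p, hp, h0, h⟩ := tan 0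
    refine mul_eq_sq_of_mul_add_eq_zero (u := p 1) (v := p 2) ?_ ?_ ?_
    · by_contra! hc
      exact hp (by ext i; fin_cases i <;> simp [h0, hc])
    · simpa [h0] using h 1 (by decide)
    · simpa [h0, hM 2 1] using h 2 (by decide)
  have h02 : M 0 0 * M 2 2 = M 0 2 ^ 2 := by
    obtain ⟨p, hp, h0, h⟩ := tan 1
    refine mul_eq_sq_of_mul_add_eq_zero (u := p 0) (v := p 2) ?_ ?_ ?_
    · by_contra! hc
      exact hp (by ext i; fin_cases i <;> simp [h0, hc])
    · simpa [h0] using h 0 (by decide)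
    · simpa [h0, hM 2 0] using h 2 (by decide)
  have h01 : M 0 0 * M 1 1 = M 0 1 ^ 2 := by
    obtain ⟨p, hp, h0, h⟩ := tan 2
    refine mul_eq_sq_of_mul_add_eq_zero (u := p 0) (v := p 1) ?_ ?_ ?_
    · by_contra! hc
      exact hp (by ext i; fin_cases i <;> simp [h0, hc])
    · simpa [h0] using h 0 (by decide)
    · simpa [h0, hM 1 0] using h 1 (by decide)
  have hdet : M 0 1 * M 0 2 * M 1 2 - M 0 0 * M 1 1 * M 2 2 ≠ 0 := by
    intro hd
    have hdet : (Matrix.of M).det = 0 := by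
      rw [Matrix.det_fin_three]
      simp only [Matrix.of_apply, hM 1 0, hM 2 0, hM 2 1]
      linear_combination 2 * hd + M 0 0 * h12 + M 1 1 * h02 + M 2 2 * h01
    obtain ⟨v, hv, hMv⟩ := Matrix.exists_mulVec_eq_zero_iff.mpr hdet
    refine hv (hker v fun i => ?_)
    simpa [Matrix.mulVec, dotProduct, Fin.sum_univ_three] using congr_fun hMv i
  have hsum : M 0 1 * M 0 2 * M 1 2 = -(M 0 0 * M 1 1 * M 2 2) := by
    have : (M 0 1 * M 0 2 * M 1 2 - M 0 0 * M 1 1 * M 2 2) *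
        (M 0 1 * M 0 2 * M 1 2 + M 0 0 * M 1 1 * M 2 2) = 0 := by
      have e : (M 0 1 * M 0 2 * M 1 2) ^ 2 = (M 0 0 * M 1 1 * M 2 2) ^ 2 := by
        rw [mul_pow, mul_pow, ← h01, ← h02, ← h12]; ring
      linear_combination e
    exact eq_neg_of_add_eq_zero_left ((mul_eq_zero.mp this).resolve_left hdet)
  have habc : M 0 0 * M 1 1 * M 2 2 ≠ 0 := fun h => hdet (by rw [hsum, h]; simp)
  have ha : M 0 0 ≠ 0 := fun h => habc (by simp [h])
  have hb : M 1 1 ≠ 0 := fun h => habc (by simp [h])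
  have hc : M 2 2 ≠ 0 := fun h => habc (by simp [h])
  have hd : M 1 2 ≠ 0 := fun h => mul_ne_zero hb hc (by simp [h12, h])
  obtain ⟨r, hr⟩ := IsAlgClosed.exists_pow_nat_eq (M 0 0) two_pos
  replace hr := hr.symm
  have hr0 : r ≠ 0 := fun h => ha (by simp [hr, h])
  have l11 : (-M 0 1 / r) ^ 2 = M 1 1 := by
    rw [div_pow, neg_sq, ← h01, ← hr, mul_div_cancel_left₀ _ ha]
  have l22 : (-M 0 2 / r) ^ 2 = M 2 2 := by
    rw [div_pow, neg_sq, ← h02, ← hr, mul_div_cancel_left₀ _ ha]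
  have l12 : (-M 0 1 / r) * (-M 0 2 / r) = -M 1 2 := by
    rw [div_mul_div_comm, ← sq, ← hr, div_eq_iff ha]
    apply mul_right_cancel₀ hd
    linear_combination hsum - M 0 0 * h12
  have l01 : r * (-M 0 1 / r) = - M 0 1 := by field_simp
  have l02 : r * (-M 0 2 / r) = - M 0 2 := by field_simp
  generalize -M 0 1 / r = s at *
  generalize -M 0 2 / r = t at *
  have hs0 : s ≠ 0 := fun h => hb (by rw [← l11, h]; ring)
  have ht0 : t ≠ 0 := fun h => hc (by rw [← l22, h]; ring)
  refine ⟨![r, s, t], fun i => ?_, ?_⟩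
  · fin_cases i
    exacts [hr0, hs0, ht0]
  · have e12 : M 1 2 = -(s * t) := by rw [l12, neg_neg]
    have e01 : M 0 1 = -(r * s) := by rw [l01, neg_neg]
    have e02 : M 0 2 = -(r * t) := by rw [l02, neg_neg]
    rw [hfM]
    simp only [tritangentConic, Fin.sum_univ_three, hM 1 0, hM 2 0, hM 2 1, e12, e01, e02, hr,
      ← l11, ← l22, Matrix.cons_val, C_neg, C_mul, C_pow]
    ring

/-! ### Equation and singular locus of the pull-back -/

theorem pullbackEquation_tritangentConic (n : ℕ) (l : Fin 3 → ℂ) :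
    pullbackEquation n (tritangentConic l) =
      2 * ∑ i, (C (l i) * X i ^ n) ^ 2 - (∑ i, C (l i) * X i ^ n) ^ 2 := by
  have h2 : (2 : MvPolynomial (Fin 3) ℂ) = C 2 := (map_ofNat C 2).symm
  simp only [pullbackEquation, tritangentConic, h2, map_sub, map_mul, map_pow, map_sum, aeval_X,
    aeval_C, algebraMap_eq]

theorem eval_pullbackEquation_tritangentConic (n : ℕ) (l x : Fin 3 → ℂ) :
    eval x (pullbackEquation n (tritangentConic l)) =
      2 * ∑ i, (l i * x i ^ n) ^ 2 - (∑ i, l i * x i ^ n) ^ 2 := by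
  simp [pullbackEquation_tritangentConic]

theorem eval_pullbackEquation_tritangentConic_eq (n : ℕ) (l x : Fin 3 → ℂ) {i j k : Fin 3}
    (hij : i ≠ j) (hik : i ≠ k) (hjk : j ≠ k) :
    eval x (pullbackEquation n (tritangentConic l)) =
      (l i * x i ^ n + l j * x j ^ n - l k * x k ^ n) ^ 2 -
        4 * l i * l j * (x i ^ n * x j ^ n) := by
  rw [eval_pullbackEquation_tritangentConic, Fin.sum_univ_three, Fin.sum_univ_three]
  revert hij hik hjk
  fin_cases i <;> fin_cases j <;> fin_cases k <;> simp <;> ring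

theorem eval_pderiv_pullbackEquation_tritangentConic (n : ℕ) (l x : Fin 3 → ℂ) (i : Fin 3) :
    eval x (pderiv i (pullbackEquation n (tritangentConic l))) =
      2 * n * l i * x i ^ (n - 1) * (2 * (l i * x i ^ n) - ∑ j, l j * x j ^ n) := by
  have h2 (j : Fin 3) : pderiv j (2 : MvPolynomial (Fin 3) ℂ) = 0 := by
    rw [show (2 : MvPolynomial (Fin 3) ℂ) = C 2 from (map_ofNat C 2).symm, pderiv_C]
  rw [pullbackEquation_tritangentConic]
  fin_cases i <;>
    simp [Fin.sum_univ_three, pderiv_X, Derivation.leibniz_pow, h2] <;> ring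

/-- The nonzero vectors among these `x` represent the singular points of the pull-back. -/
theorem eval_and_pderiv_pullbackEquation_eq_zero_iff {n : ℕ} (hn : 2 ≤ n) {l : Fin 3 → ℂ} (hl : ∀ i, l i ≠ 0) (x : Fin 3 → ℂ) :
    (eval x (pullbackEquation n (tritangentConic l)) = 0 ∧
      ∀ i, eval x (pderiv i (pullbackEquation n (tritangentConic l))) = 0) ↔
    ∃ i : Fin 3, x i = 0 ∧
      l (i.succAbove 0) * x (i.succAbove 0) ^ n = l (i.succAbove 1) * x (i.succAbove 1) ^ n := by
  have hn0 : n ≠ 0 := by omega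
  constructor
  · rintro ⟨h0, hd⟩
    obtain ⟨i, hi⟩ : ∃ i, x i = 0 := by
      by_contra! hx
      have h (i) : 2 * (l i * x i ^ n) = ∑ j, l j * x j ^ n := by
        have := hd i
        rw [eval_pderiv_pullbackEquation_tritangentConic] at this
        have h2 : 2 * n * l i * x i ^ (n - 1) ≠ 0 := by simp [hl, hx, hn0]
        exact sub_eq_zero.mp ((mul_eq_zero.mp this).resolve_left h2)
      -- Adding the equations `2yᵢ = y₀ + y₁ + y₂` for `i = 1, 2` gives `y₀ = 0`.
      have hS : l 0 * x 0 ^ n = 0 := by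
        have h0 := h 0
        have h1 := h 1
        have h2 := h 2
        rw [Fin.sum_univ_three] at h0 h1 h2
        linear_combination 0 * h0 - (1 / 2) * h1 - (1 / 2) * h2
      simp [hl, hx] at hS
    refine ⟨i, hi, ?_⟩
    rw [eval_pullbackEquation_tritangentConic_eq n l x (i := i) (j := i.succAbove 0)
      (k := i.succAbove 1) (Fin.succAbove_ne _ _).symm (Fin.succAbove_ne _ _).symm (by simp), hi,
      zero_pow hn0] at h0
    have h0 : (l (i.succAbove 0) * x (i.succAbove 0) ^ n -
      l (i.succAbove 1) * x (i.succAbove 1) ^ n) ^ 2 = 0 := by linear_combination h0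
    exact sub_eq_zero.mp (pow_eq_zero_iff two_ne_zero |>.mp h0)
  · rintro ⟨i, hi, h⟩
    constructor
    · rw [eval_pullbackEquation_tritangentConic_eq n l x (i := i) (j := i.succAbove 0)
        (k := i.succAbove 1) (Fin.succAbove_ne _ _).symm (Fin.succAbove_ne _ _).symm (by simp), hi,
        zero_pow hn0, h]
      ring
    · intro m
      rw [eval_pderiv_pullbackEquation_tritangentConic, Fin.sum_univ_succAbove _ i]
      rcases Fin.eq_self_or_eq_succAbove i m with rfl | ⟨j, rfl⟩
      -- The factor `xᵢⁿ⁻¹` vanishes only because `n ≥ 2`.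
      · rw [hi, zero_pow (by omega : n - 1 ≠ 0)]; ring
      · rw [hi, zero_pow hn0, Fin.sum_univ_two]
        fin_cases j <;> simp [h] <;> ring_nf <;> simp

/-! ### Degree and squarefreeness -/

theorem isReducedCurveOfDegree_pullbackEquation {n : ℕ} (hn : 2 ≤ n) {l : Fin 3 → ℂ}
    (hl : ∀ i, l i ≠ 0) :
    IsReducedCurveOfDegree (pullbackEquation n (tritangentConic l)) (2 * n) := by
  have hn0 : n ≠ 0 := by omega
  have hev (i : Fin 3) :
      eval (Pi.single i 1) (pullbackEquation n (tritangentConic l)) ≠ 0 := by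
    rw [eval_pullbackEquation_tritangentConic]
    simp only [Pi.single_apply, ite_pow, one_pow, zero_pow hn0, mul_ite, mul_one, mul_zero,
      Finset.sum_ite_eq', Finset.mem_univ, if_true, ne_eq, OfNat.ofNat_ne_zero, not_false_eq_true,
      zero_pow]
    intro h
    exact hl i (pow_eq_zero_iff two_ne_zero |>.mp (by linear_combination h))
  have hF0 : pullbackEquation n (tritangentConic l) ≠ 0 := fun h => hev 0 (by simp [h])
  have hhom : (pullbackEquation n (tritangentConic l)).IsHomogeneous (2 * n) := by
    have h (i) : (C (l i) * X i ^ n : MvPolynomial (Fin 3) ℂ).IsHomogeneous n := by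
      simpa using (isHomogeneous_C (Fin 3) (l i)).mul ((isHomogeneous_X ℂ i).pow n)
    have h2 : (2 : MvPolynomial (Fin 3) ℂ).IsHomogeneous 0 := by
      rw [show (2 : MvPolynomial (Fin 3) ℂ) = C 2 from (map_ofNat C 2).symm]
      exact isHomogeneous_C _ _
    rw [pullbackEquation_tritangentConic, mul_comm 2 n]
    refine IsHomogeneous.sub ?_ ((IsHomogeneous.sum _ _ _ fun i _ => h i).pow 2)
    simpa using h2.mul (IsHomogeneous.sum Finset.univ _ _ fun i _ => (h i).pow 2)
  refine ⟨hhom, hhom.totalDegree hF0, ?_⟩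
  rw [squarefree_iff_no_irreducibles hF0]
  rintro p hp ⟨q, hq⟩
  have hprime : Prime p := hp.prime
  -- Nullstellensatz: zeros of a repeated factor are singular, so `x₀x₁x₂` vanishes on them.
  have hdvd : p ∣ ∏ i, X i := by
    have : (Ideal.span {p}).IsPrime := (Ideal.span_singleton_prime hp.ne_zero).mpr hprime
    rw [← Ideal.mem_span_singleton, ← IsPrime.vanishingIdeal_zeroLocus (K := ℂ) (Ideal.span {p})]
    intro x hx
    have hpx : eval x p = 0 := by
      simpa [coe_aeval_eq_eval] using hx p (Ideal.mem_span_singleton_self p)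
    obtain ⟨i, hi, -⟩ := (eval_and_pderiv_pullbackEquation_eq_zero_iff hn hl x).mp (by
      rw [hq]
      constructor
      · simp [hpx]
      · intro i
        simp [Derivation.leibniz, hpx])
    simpa using Finset.prod_eq_zero (Finset.mem_univ i) hi
  obtain ⟨i, -, hi⟩ := hprime.exists_mem_finset_dvd hdvd
  have hXF : X i ∣ pullbackEquation n (tritangentConic l) :=
    ((hp.associated_of_dvd X_prime.irreducible hi).symm.dvd).trans ⟨p * q, by rw [hq]; ring⟩
  obtain ⟨g, hg⟩ := hXF
  -- This coordinate point lies on `xᵢ = 0` but not on the curve.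
  apply hev (i + 1)
  rw [hg]
  simp

/-! ### Counting the singular points -/

theorem encard_pow_eq {n : ℕ} (hn : n ≠ 0) {c : ℂ} (hc : c ≠ 0) :
    {z : ℂ | z ^ n = c}.encard = n := by
  classical
  have hζ := Complex.isPrimitiveRoot_exp n hn
  have : {z : ℂ | z ^ n = c} = ((Polynomial.nthRoots n c).toFinset : Set ℂ) := by
    ext z
    simp [Polynomial.mem_nthRoots (Nat.pos_of_ne_zero hn)]
  rw [this, Set.encard_coe_eq_coe_finsetCard, Multiset.toFinset_card_of_nodup (hζ.nthRoots_nodup hc),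
    hζ.card_nthRoots, if_pos (IsAlgClosed.exists_pow_nat_eq c (Nat.pos_of_ne_zero hn))]

theorem mem_singularPoints_iff {n : ℕ} (hn : 2 ≤ n) {l : Fin 3 → ℂ} (hl : ∀ i, l i ≠ 0)
    (p : ProjPlane) :
    p ∈ singularPoints (pullbackEquation n (tritangentConic l)) ↔
    ∃ i : Fin 3, p.rep i = 0 ∧ l (i.succAbove 0) * p.rep (i.succAbove 0) ^ n =
      l (i.succAbove 1) * p.rep (i.succAbove 1) ^ n :=
  eval_and_pderiv_pullbackEquation_eq_zero_iff hn hl p.rep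

theorem ne_zero_of_apply_eq_zero {n : ℕ} (hn : n ≠ 0) {l x : Fin 3 → ℂ} (hl : ∀ i, l i ≠ 0)
    (hx : x ≠ 0) {i : Fin 3} (hi : x i = 0)
    (h : l (i.succAbove 0) * x (i.succAbove 0) ^ n = l (i.succAbove 1) * x (i.succAbove 1) ^ n)
    (j : Fin 3) (hj : j ≠ i) : x j ≠ 0 := by
  intro hj0
  apply hx
  obtain ⟨s, rfl⟩ := Fin.exists_succAbove_eq hj
  have h0 : x (i.succAbove 0) = 0 ∧ x (i.succAbove 1) = 0 := by
    fin_cases s <;> simp_all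
  ext m
  rcases Fin.eq_self_or_eq_succAbove i m with rfl | ⟨t, rfl⟩
  · exact hi
  · fin_cases t
    · exact h0.1
    · exact h0.2

theorem encard_singularPoints_pullbackEquation {n : ℕ} (hn : 2 ≤ n) {l : Fin 3 → ℂ}
    (hl : ∀ i, l i ≠ 0) :
    (singularPoints (pullbackEquation n (tritangentConic l))).encard = 3 * n := by
  have hn0 : n ≠ 0 := by omega
  set c : Fin 3 → ℂ := fun i => l (i.succAbove 1) / l (i.succAbove 0) with hcdef
  have hc (i) : c i ≠ 0 := div_ne_zero (hl _) (hl _)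
  -- Representatives normalised to have last coordinate off `i` equal to 1; the other is an `n`-th
  -- root of `c i`.
  set v : (Σ i, {z : ℂ | z ^ n = c i}) → Fin 3 → ℂ :=
    fun q => q.1.insertNth (α := fun _ => ℂ) 0 ![q.2.1, 1] with hvdef
  have vi (q) : v q q.1 = 0 := by simp [hvdef]
  have v0 (q) : v q (q.1.succAbove 0) = q.2.1 := by simp [hvdef]
  have v1 (q) : v q (q.1.succAbove 1) = 1 := by simp [hvdef]
  have hv (q) : v q ≠ 0 := fun h => one_ne_zero ((v1 q).symm.trans (by rw [h]; rfl))
  have hvl (q) : l (q.1.succAbove 0) * v q (q.1.succAbove 0) ^ n =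
      l (q.1.succAbove 1) * v q (q.1.succAbove 1) ^ n := by
    rw [v0, v1, show q.2.1 ^ n = c q.1 from q.2.2, one_pow, mul_one]
    exact mul_div_cancel₀ _ (hl _)
  set g : (Σ i, {z : ℂ | z ^ n = c i}) → ProjPlane :=
    fun q => Projectivization.mk ℂ (v q) (hv q) with hgdef
  have hinj : Function.Injective g := by
    intro q r hqr
    obtain ⟨a, ha⟩ := (Projectivization.mk_eq_mk_iff' ℂ _ _ (hv q) (hv r)).mp hqr
    have hi : q.1 = r.1 := by
      by_contra hne
      have h1 := congr_fun ha r.1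
      have h2 := ne_zero_of_apply_eq_zero hn0 hl (hv q) (vi q) (hvl q) r.1 (Ne.symm hne)
      rw [Pi.smul_apply, vi, smul_zero] at h1
      exact h2 h1.symm
    obtain ⟨i, z⟩ := q
    obtain ⟨j, w⟩ := r
    obtain rfl : i = j := hi
    have h1 := congr_fun ha (i.succAbove 1)
    have h0 := congr_fun ha (i.succAbove 0)
    rw [Pi.smul_apply, v1 ⟨i, z⟩, v1 ⟨i, w⟩, smul_eq_mul, mul_one] at h1
    rw [Pi.smul_apply, v0 ⟨i, z⟩, v0 ⟨i, w⟩, h1, one_smul] at h0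
    rw [show z = w from Subtype.ext h0.symm]
  have hrange : singularPoints (pullbackEquation n (tritangentConic l)) = Set.range g := by
    ext p
    rw [mem_singularPoints_iff hn hl]
    constructor
    · rintro ⟨i, hi, h⟩
      have hne := ne_zero_of_apply_eq_zero hn0 hl p.rep_nonzero hi h
      have h1 := hne (i.succAbove 1) (Fin.succAbove_ne _ _)
      have hz : (p.rep (i.succAbove 0) / p.rep (i.succAbove 1)) ^ n = c i := by
        have := hl (i.succAbove 0)
        rw [div_pow, hcdef]
        field_simp
        linear_combination h
      refine ⟨⟨i, _, hz⟩, ?_⟩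
      conv_rhs => rw [← p.mk_rep]
      rw [hgdef, Projectivization.mk_eq_mk_iff']
      refine ⟨(p.rep (i.succAbove 1))⁻¹, ?_⟩
      ext m
      rcases Fin.eq_self_or_eq_succAbove i m with rfl | ⟨t, rfl⟩
      · simp [hi, hvdef]
      · fin_cases t <;> simp [hvdef, h1, div_eq_inv_mul]
    · rintro ⟨q, rfl⟩
      obtain ⟨a, ha⟩ := Projectivization.exists_smul_eq_mk_rep ℂ _ (hv q)
      refine ⟨q.1, ?_, ?_⟩
      · rw [hgdef, ← ha, Pi.smul_apply, vi, smul_zero]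
      · simp only [hgdef, ← ha, Pi.smul_apply, Units.smul_def, smul_eq_mul, mul_pow]
        linear_combination (a : ℂ) ^ n * hvl q
  have hfin (i) : ENat.card {z : ℂ | z ^ n = c i} = n := encard_pow_eq hn0 (hc i)
  have hF (i) : Finite {z : ℂ | z ^ n = c i} := by
    rw [← ENat.card_lt_top, hfin]
    exact ENat.natCast_lt_top n
  have hnat (i) : Nat.card {z : ℂ | z ^ n = c i} = n := by
    rw [← ENat.toNat_natCast (Nat.card _), ← ENat.card_eq_coe_natCard, hfin, ENat.toNat_natCast]
  rw [hrange, ← Set.image_univ, hinj.encard_image, Set.encard_univ, ENat.card_eq_coe_natCard,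
    Nat.card_sigma]
  simp only [hnat]
  simp

/-! ### Local analytic type -/

/-- The analytic inverse function theorem, for a map that is analytic everywhere. -/
theorem exists_openPartialHomeomorph_of_analyticOnNhd {E : Type*} [NormedAddCommGroup E]
    [NormedSpace ℂ E] [CompleteSpace E] {f : E → E} (hf : AnalyticOnNhd ℂ f Set.univ) {a : E}
    {f' : E ≃L[ℂ] E} (hfa : HasFDerivAt f (f' : E →L[ℂ] E) a) :
    ∃ φ : OpenPartialHomeomorph E E, (φ : E → E) = f ∧ a ∈ φ.source ∧
      AnalyticOnNhd ℂ φ.symm φ.target := by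
  have hs : HasStrictFDerivAt f (f' : E →L[ℂ] E) a := by
    have := (hf a (Set.mem_univ a)).hasStrictFDerivAt
    rwa [hfa.fderiv] at this
  -- Restricting to invertible derivatives makes the inverse analytic on the whole target.
  have hopen : IsOpen {w | fderiv ℂ f w ∈ Set.range ((↑) : (E ≃L[ℂ] E) → E →L[ℂ] E)} := by
    have hc : Continuous (fderiv ℂ f) := continuousOn_univ.mp hf.fderiv.continuousOn
    exact ContinuousLinearEquiv.isOpen.preimage hc
  refine ⟨(hs.toOpenPartialHomeomorph f).restrOpen _ hopen, rfl,
    ⟨hs.mem_toOpenPartialHomeomorph_source, f', hfa.fderiv.symm⟩, fun w hw => ?_⟩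
  obtain ⟨-, i, hi⟩ := OpenPartialHomeomorph.map_target _ hw
  exact OpenPartialHomeomorph.analyticAt_symm _ hw (hf _ (Set.mem_univ _)) hi.symm

theorem isTypeAAt_of_eq {n : ℕ} (hn : 2 ≤ n) (b α β γ : ℂ) (hb : b ≠ 0) (hβ : β ≠ 0)
    {s t : Fin 2} (hst : s ≠ t) {g : (Fin 2 → ℂ) → ℂ} {a : Fin 2 → ℂ} (has : a s = 0)
    (hat : a t ≠ 0) (ha : β * a t ^ n = γ)
    (hg : ∀ w, g w = (α * w s ^ n + β * w t ^ n - γ) ^ 2 - (b * w s * w t) ^ n) :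
    IsTypeAAt (n - 1) g a := by
  have hp (i : Fin 2) : AnalyticOnNhd ℂ (fun w : Fin 2 → ℂ => w i) Set.univ :=
    (ContinuousLinearMap.proj (R := ℂ) (φ := fun _ : Fin 2 => ℂ) i).analyticOnNhd _
  have han : AnalyticOnNhd ℂ (fun w : Fin 2 → ℂ =>
      (![b * w s * w t, α * w s ^ n + β * w t ^ n - γ] : Fin 2 → ℂ)) Set.univ := by
    intro w hw
    have h1 := hp s w hw
    have h2 := hp t w hw
    refine analyticAt_pi_iff.mpr fun i => ?_
    fin_cases i
    · exact (analyticAt_const.mul h1).mul h2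
    · exact ((analyticAt_const.mul (h1.pow n)).add (analyticAt_const.mul (h2.pow n))).sub
        analyticAt_const
  let π (i : Fin 2) : (Fin 2 → ℂ) →L[ℂ] ℂ := ContinuousLinearMap.proj i
  -- The derivative at `a` is diagonal up to order, as `a s = 0` and `n ≥ 2` kill the other terms.
  let D : (Fin 2 → ℂ) →L[ℂ] (Fin 2 → ℂ) :=
    ContinuousLinearMap.pi ![(b * a t) • π s, (β * (n * a t ^ (n - 1))) • π t]
  have hD : Function.Injective D := by
    rw [injective_iff_map_eq_zero]
    intro w hw
    have h0 : b * a t * w s = 0 := congr_fun hw 0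
    have h1 : β * (n * a t ^ (n - 1)) * w t = 0 := congr_fun hw 1
    have hn0 : n ≠ 0 := by omega
    have hs0 : w s = 0 := by simpa [hb, hat] using h0
    have ht0 : w t = 0 := by simpa [hβ, hat, hn0] using h1
    ext i
    obtain rfl | rfl : i = s ∨ i = t := by omega
    · exact hs0
    · exact ht0
  let D' : (Fin 2 → ℂ) ≃L[ℂ] (Fin 2 → ℂ) :=
    (LinearEquiv.ofInjectiveEndo D.toLinearMap hD).toContinuousLinearEquiv
  have hder : HasFDerivAt (fun w : Fin 2 → ℂ =>
      (![b * w s * w t, α * w s ^ n + β * w t ^ n - γ] : Fin 2 → ℂ))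
      (D' : (Fin 2 → ℂ) →L[ℂ] (Fin 2 → ℂ)) a := by
    have hDD : (D' : (Fin 2 → ℂ) →L[ℂ] (Fin 2 → ℂ)) = D := rfl
    rw [hDD]
    have hs : HasFDerivAt (fun w : Fin 2 → ℂ => w s) (π s) a := (π s).hasFDerivAt
    have ht : HasFDerivAt (fun w : Fin 2 → ℂ => w t) (π t) a := (π t).hasFDerivAt
    refine hasFDerivAt_pi.mpr fun i => ?_
    fin_cases i
    · refine ((hs.const_mul b).mul ht).congr_fderiv ?_
      ext w
      simp [has]
      ring
    · refine ((((hs.pow n).const_mul α).add ((ht.pow n).const_mul β)).sub_const γ).congr_fderiv ?_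
      ext w
      simp [has, zero_pow (by omega : n - 1 ≠ 0)]
      ring
  obtain ⟨φ, hφ, haφ, hsymm⟩ := exists_openPartialHomeomorph_of_analyticOnNhd han hder
  refine ⟨φ, fun _ => 1, haφ, ?_, ?_, hsymm, fun _ _ => analyticAt_const, fun w _ => ⟨one_ne_zero, ?_⟩⟩
  · rw [hφ]
    ext i
    fin_cases i <;> simp [has, ha, zero_pow (by omega : n ≠ 0)]
  · rw [hφ]
    exact han.mono (Set.subset_univ _)
  · rw [hφ, hg, Nat.sub_add_cancel (by omega)]
    simp

theorem hasLocalTypeA_pullbackEquation {n : ℕ} (hn : 2 ≤ n) {l : Fin 3 → ℂ} (hl : ∀ i, l i ≠ 0)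
    {p : ProjPlane} (hp : p ∈ singularPoints (pullbackEquation n (tritangentConic l))) :
    HasLocalTypeA (n - 1) (pullbackEquation n (tritangentConic l)) p := by
  obtain ⟨i, hi, h⟩ := (mem_singularPoints_iff hn hl p).mp hp
  have hne := ne_zero_of_apply_eq_zero (by omega) hl p.rep_nonzero hi h
  set k := i.succAbove 1 with hk
  set j := i.succAbove 0 with hj
  have hki : k ≠ i := Fin.succAbove_ne _ _
  have hji : j ≠ i := Fin.succAbove_ne _ _
  have hjk : j ≠ k := by simp [hk, hj]
  have hk0 := hne k hki
  obtain ⟨s, hs⟩ := Fin.exists_succAbove_eq hki.symm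
  obtain ⟨t, ht⟩ := Fin.exists_succAbove_eq hjk
  have hst : s ≠ t := by
    rintro rfl
    exact hji (ht.symm.trans hs)
  obtain ⟨b, hb⟩ := IsAlgClosed.exists_pow_nat_eq (4 * l i * l j) (by omega : 0 < n)
  have hb0 : b ≠ 0 := by
    rintro rfl
    rw [zero_pow (by omega)] at hb
    simp [hl] at hb
  refine ⟨k, hk0, isTypeAAt_of_eq hn b (l i) (l j) (l k) hb0 (hl j) hst ?_ ?_ ?_ fun w => ?_⟩
  · rw [hs, hi, zero_div]
  · rw [ht]
    exact div_ne_zero (hne j hji) hk0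
  · rw [ht, div_pow, ← mul_div_assoc, h, mul_div_cancel_right₀ _ (pow_ne_zero n hk0)]
  · rw [eval_pullbackEquation_tritangentConic_eq n l _ hji.symm hki.symm hjk]
    have ws : k.insertNth (α := fun _ => ℂ) 1 w i = w s := by
      rw [← hs, Fin.insertNth_apply_succAbove]
    have wt : k.insertNth (α := fun _ => ℂ) 1 w j = w t := by
      rw [← ht, Fin.insertNth_apply_succAbove]
    rw [ws, wt, Fin.insertNth_apply_same, mul_pow, mul_pow, hb]
    ring

end

theorem mainTheorem3 (f : MvPolynomial (Fin 3) ℂ) (hf : IsNonsingularConic f)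
    (htan : ∀ i : Fin 3, IsTangentTo f (coordLine i)) (n : ℕ) (hn : 2 ≤ n) :
    IsReducedCurveOfDegree (pullbackEquation n f) (2 * n) ∧
    (singularPoints (pullbackEquation n f)).encard = 3 * n ∧
    ∀ p ∈ singularPoints (pullbackEquation n f),
      HasLocalTypeA (n - 1) (pullbackEquation n f) p := by
  obtain ⟨l, hl, rfl⟩ := hf.eq_tritangentConic htan
  exact ⟨isReducedCurveOfDegree_pullbackEquation hn hl,
    encard_singularPoints_pullbackEquation hn hl,
    fun _ hp => hasLocalTypeA_pullbackEquation hn hl hp⟩
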